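/- Let $\overline{\mathbb{Q}}\subset\mathbb{C}$ be the field of algebraic numbers, $B(0,1)$ the open unit disc in $\mathbb{C}$, and $\mathbb{Z}\{z\}$ the set of power series with integer coefficients that converge on $B(0,1)$. For $\psi=\sum_{n\ge 0}a_nz^n\in\mathbb{Z}\{z\}$, regarded as a function on $B(0,1)$, put $S_\psi=\{\alpha\in\overline{\mathbb{Q}}\cap B(0,1):\psi(\alpha)\in\overline{\mathbb{Q}}\}$ and $L_0(\psi)=\{n\ge 0: a_n=0\}$; $\psi$ is transcendental if there is no nonzero $Q\in\mathbb{C}[X,Y]$ with $Q(z,\psi(z))=0$ for all $z\in B(0,1)$. For $\mathcal{A}\subseteq\mathbb{Z}_{\ge 0}$ let $\mathcal{A}(x)=\mathcal{A}\cap[0,x]$, let $\underline{\delta}(\mathcal{A})=\liminf_{n\to\infty}\#\mathcal{A}(n)/n$ be its lower density, and $\delta(\mathcal{A})=\lim_{x\to\infty}\#\mathcal{A}(x)/x$ its natural density (if the limit exists). Let $\mu_k$ be the set of complex $k$-th roots of unity. Let $\ell$ be a positive integer, and let $S\subseteq\overline{\mathbb{Q}}\cap B(0,1)$ be a set that is closed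 under complex conjugation, contains $0$, and satisfies $\mu_\ell\cdot S\subseteq S$. Then there exist uncountably many transcendental functions $\psi\in\mathbb{Z}\{z\}$ such that $$S_\psi=S\quad\text{and}\quad \underline{\delta}(L_0(\psi))\ge 1-\frac1\ell.$$ Furthermore, if $\mu_k\cdot S\subseteq S$ for infinitely many positive integers $k$, then there exist uncountably many transcendental functions $\psi\in\mathbb{Z}\{z\}$ such that $S_\psi=S$ and $\delta(L_0(\psi))=1$. -/

import Mathlib

open Filter Topology
open scoped Pointwise ComplexConjugate

noncomputable section

namespace MahlerExceptional

/-- The `n`-th term `aₙ zⁿ` of a power series with integer coefficients. -/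
def term (f : PowerSeries ℤ) (z : ℂ) (n : ℕ) : ℂ :=
  ((PowerSeries.coeff n f : ℤ) : ℂ) * z ^ n

/-- The ring `ℤ{z}`: power series with integer coefficients that converge
(hence define an analytic function) on the open unit disc. -/
def IntegerAnalytic : Set (PowerSeries ℤ) :=
  {f | ∀ z ∈ Metric.ball (0 : ℂ) 1, Summable (term f z)}

/-- The value `f(z)`; it is only used for `f ∈ ℤ{z}` and `z` in the open unit disc. -/
def value (f : PowerSeries ℤ) (z : ℂ) : ℂ := ∑' n, term f z n

/-- `f` is a transcendental function on the open unit disc: no nonzero polynomial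
`Q(X, Y)` with complex coefficients satisfies `Q(z, f(z)) = 0` identically there. -/
def IsTranscendentalFunction (f : PowerSeries ℤ) : Prop :=
  ∀ Q : Polynomial (Polynomial ℂ),
    (∀ z ∈ Metric.ball (0 : ℂ) 1, Q.evalEval z (value f z) = 0) → Q = 0

/-- The exceptional set `S_f`: algebraic numbers in the open unit disc (the domain of `f`)
at which `f` takes an algebraic value. -/
def exceptionalSet (f : PowerSeries ℤ) : Set ℂ :=
  {α | IsAlgebraic ℚ α ∧ α ∈ Metric.ball (0 : ℂ) 1 ∧ IsAlgebraic ℚ (value f α)}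

/-- The set `L₀(f)` of indices of zero coefficients. -/
def zeroIndices (f : PowerSeries ℤ) : Set ℕ := {n | PowerSeries.coeff n f = 0}

/-- `#(A ∩ [0, x])`. -/
def count (A : Set ℕ) (x : ℝ) : ℕ := {n | n ∈ A ∧ (n : ℝ) ≤ x}.ncard

/-- The set `A` has natural density `d`. -/
def HasNaturalDensity (A : Set ℕ) (d : ℝ) : Prop :=
  Tendsto (fun x : ℝ => (count A x : ℝ) / x) atTop (𝓝 d)

/-- The lower asymptotic density of `A` (the quotient lies in `[0, 2]` for every `n`). -/
def lowerDensity (A : Set ℕ) : ℝ :=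
  liminf (fun n : ℕ => (count A n : ℝ) / n) atTop

/-- The set `μ_k` of complex `k`-th roots of unity (used for `k ≥ 1`). -/
def rootsOfUnitySet (k : ℕ) : Set ℂ := {ζ | ζ ^ k = 1}

end MahlerExceptional

end

noncomputable section

namespace MahlerExceptional

/-! Build `ψ = ∑ z ^ j ^ 3 * b j`, with `b j` an integer polynomial of degree at most `j`. Exhaust
the nonzero algebraic numbers of the disc by finite conjugation-stable sets `E j`, and prescribe
that a point `α` entering at time `t` gets the value (partial sum before `t`) `+ α ^ t ^ 3 * s α`,
where `s` is `0` on `S` and a real transcendental number `τ` off `S`. The partial sum is algebraic,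
so `ψ(α)` is algebraic exactly when `α ∈ S`; at `0` the value is an integer.

The prescription is met by successive approximation (`exists_blocks`): interpolate the residual
divided by `α ^ j ^ 3` on `E j` and round the coefficients. Rounding leaves a residual of at most
`(j + 1) * ‖α‖ ^ j ^ 3`, so the next block pays only for the gap between consecutive cubes, a factor
`R ^ O(j ^ 2)`. If `E j` grows slowly enough (`exists_exhaustion`), the coefficients are
subexponential in `j ^ 3` and `ψ` converges on the disc. The support lies in the sparse intervals
`[j ^ 3, j ^ 3 + j]`, so the zero coefficients have density one, which gives both density claims.

The top coefficient of each block is a free bit, used to diagonalise against any countable family.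
Non-transcendental members of `ℤ{z}` form such a family, hence uncountably many transcendental `ψ`
remain. -/

/-! ### Integer interpolation and successive approximation. -/

open Polynomial in
/-- Conjugation-symmetric data on `E` can be approximated by integer polynomials of degree below
`E.card`, up to an error `E.card` and with coefficients controlled linearly, with slope `K`, by
the data. -/
def ApproximationBound (E : Finset ℂ) (K : ℝ) : Prop :=
  0 ≤ K ∧ ∀ w : ℂ → ℂ, (∀ α ∈ E, w (conj α) = conj (w α)) →
    ∃ b : ℤ[X], (∀ i, E.card ≤ i → b.coeff i = 0) ∧
      (∀ α ∈ E, ‖w α - aeval α b‖ ≤ E.card) ∧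
      ∀ M, 0 ≤ M → (∀ α ∈ E, ‖w α‖ ≤ M) → ∀ i, |((b.coeff i : ℤ) : ℝ)| ≤ K * M + 1

-- Round the real parts of the Lagrange coefficients. Each of the `E.card` roundings costs at most
-- `1` since `‖α‖ ≤ 1`, and the coefficients depend linearly on the data.
open Polynomial in
theorem exists_integer_approximation (E : Finset ℂ) (hE : ∀ α ∈ E, ‖α‖ ≤ 1)
    (hconj : ∀ α ∈ E, conj α ∈ E) :
    ∃ K : ℝ, ApproximationBound E K := by
  classical
  let L : ℂ → ℂ[X] := fun β => Lagrange.basis E id β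
  have hK0 : ∀ i, 0 ≤ ∑ β ∈ E, ‖(L β).coeff i‖ := fun i => Finset.sum_nonneg fun _ _ => norm_nonneg _
  refine ⟨∑ i ∈ Finset.range E.card, ∑ β ∈ E, ‖(L β).coeff i‖,
    Finset.sum_nonneg fun i _ => hK0 i, fun w hw => ?_⟩
  let p : ℂ[X] := Lagrange.interpolate E id w
  have hdeg : p.degree < E.card := Lagrange.degree_interpolate_lt _ (Set.injOn_id _)
  have hpc : ∀ i, E.card ≤ i → p.coeff i = 0 := fun i hi =>
    coeff_eq_zero_of_degree_lt (hdeg.trans_le (by exact_mod_cast hi))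
  have hpe : ∀ α ∈ E, ∑ i ∈ Finset.range E.card, p.coeff i * α ^ i = w α := by
    intro α hα
    have h := Lagrange.eval_interpolate_at_node (s := E) (v := id) w (Set.injOn_id _) hα
    rw [← h]
    rcases Nat.eq_zero_or_pos E.card with h0 | h0
    · rw [Finset.card_eq_zero] at h0; simp [h0] at hα
    · rw [id, eval_eq_sum_range' (n := E.card)]
      by_cases hp : p = 0
      · change natDegree p < _
        rw [hp]; simpa using h0
      · exact (natDegree_lt_iff_degree_lt hp).2 hdeg
  let b : ℤ[X] := ∑ i ∈ Finset.range E.card, monomial i (round (p.coeff i).re)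
  have hbc : ∀ i, b.coeff i = if i < E.card then round (p.coeff i).re else 0 := by
    intro i
    simp [b, coeff_monomial]
  refine ⟨b, fun i hi => by rw [hbc, if_neg (not_lt.2 hi)], fun α hα => ?_, fun M hM hwM i => ?_⟩
  -- Discarding imaginary parts averages `p` with its conjugate polynomial, which interpolates the
  -- same data by symmetry.
  · have h1 : ∑ i ∈ Finset.range E.card, ((p.coeff i).re : ℂ) * α ^ i = w α := by
      have h2 := hpe α hα
      have h3 := congrArg conj (hpe _ (hconj α hα))
      rw [hw α hα, Complex.conj_conj, map_sum] at h3
      have : ∀ i, ((p.coeff i).re : ℂ) * α ^ i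
          = (p.coeff i * α ^ i + conj (p.coeff i * conj α ^ i)) / 2 := by
        intro i
        rw [Complex.re_eq_add_conj, map_mul, map_pow, Complex.conj_conj]; ring
      rw [Finset.sum_congr rfl fun i _ => this i, ← Finset.sum_div, Finset.sum_add_distrib, h2, h3]
      ring
    have h4 : aeval α b = ∑ i ∈ Finset.range E.card, ((round (p.coeff i).re : ℤ) : ℂ) * α ^ i := by
      simp [b, aeval_monomial]
    rw [h4, ← h1, ← Finset.sum_sub_distrib]
    refine (norm_sum_le _ _).trans ?_
    refine (Finset.sum_le_card_nsmul _ _ 1 fun i _ => ?_).trans (by simp)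
    rw [← sub_mul, norm_mul, norm_pow]
    have h5 : ‖((p.coeff i).re : ℂ) - ((round (p.coeff i).re : ℤ) : ℂ)‖ ≤ 1 := by
      have : ((p.coeff i).re : ℂ) - ((round (p.coeff i).re : ℤ) : ℂ)
        = (((p.coeff i).re - round (p.coeff i).re : ℝ) : ℂ) := by push_cast; rfl
      rw [this, Complex.norm_real, Real.norm_eq_abs]
      exact (abs_sub_round _).trans (by norm_num)
    exact mul_le_one₀ h5 (by positivity) (pow_le_one₀ (norm_nonneg _) (hE α hα))
  · have hKM : 0 ≤ (∑ i ∈ Finset.range E.card, ∑ β ∈ E, ‖(L β).coeff i‖) * M :=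
      mul_nonneg (Finset.sum_nonneg fun i _ => hK0 i) hM
    rw [hbc]
    split_ifs with hi
    · have h1 : |(p.coeff i).re| ≤ (∑ i ∈ Finset.range E.card, ∑ β ∈ E, ‖(L β).coeff i‖) * M := by
        calc |(p.coeff i).re| ≤ ‖p.coeff i‖ := Complex.abs_re_le_norm _
          _ = ‖∑ β ∈ E, w β * (L β).coeff i‖ := by
              simp [p, L, Lagrange.interpolate_apply, coeff_C_mul]
          _ ≤ ∑ β ∈ E, ‖(L β).coeff i‖ * M := by
              refine (norm_sum_le _ _).trans (Finset.sum_le_sum fun β hβ => ?_)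
              rw [norm_mul, mul_comm]
              exact mul_le_mul_of_nonneg_left (hwM β hβ) (norm_nonneg _)
          _ ≤ _ := by
              rw [← Finset.sum_mul]
              exact mul_le_mul_of_nonneg_right
                (Finset.single_le_sum (f := fun i => ∑ β ∈ E, ‖(L β).coeff i‖)
                  (fun i _ => hK0 i) (Finset.mem_range.2 hi)) hM
      have h2 := abs_sub_round (p.coeff i).re
      rw [abs_le] at h1 h2 ⊢
      constructor <;> linarith [h1.1, h1.2, h2.1, h2.2]
    · simp; linarith

open Polynomial in
/-- Successive approximation: blocks of integer polynomials, placed at the cubes, whose sum takes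
the value `∑ j < t, … + α ^ t ^ 3 * s α` at a point `α` entering the exhaustion `E` at time `t`. -/
theorem exists_blocks (E : ℕ → Finset ℂ) (hmono : Monotone E) (h0 : E 0 = ∅)
    (hconj : ∀ j, ∀ α ∈ E j, conj α ∈ E j) (hE : ∀ j, ∀ α ∈ E j, α ≠ 0 ∧ ‖α‖ < 1)
    (hcard : ∀ j, (E j).card ≤ j) (K : ℕ → ℝ)
    (hK : ∀ j, ApproximationBound (E j) (K j))
    (s : ℂ → ℂ) (hs : ∀ α, s (conj α) = conj (s α)) (T : ℝ) (hT : ∀ α, ‖s α‖ ≤ T)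
    (e : ℕ → ℤ) (he : ∀ j, e j = 0 ∨ e j = 1) :
    ∃ b : ℕ → ℤ[X], (∀ j i, j < i → (b j).coeff i = 0) ∧ (∀ j, (b j).coeff j = e j) ∧
      (∀ j, ∀ R : ℝ, 1 ≤ R → (∀ α ∈ E j, 1 ≤ R * ‖α‖) →
        ∀ i, |(((b j).coeff i : ℤ) : ℝ)| ≤ K j * (T + j * R ^ (3 * j ^ 2)) + 1) ∧
      ∀ α t, α ∈ E t → (∀ i < t, α ∉ E i) →
        Tendsto (fun J => ∑ j ∈ Finset.range J, α ^ j ^ 3 * aeval α (b j)) atTop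
          (𝓝 (∑ j ∈ Finset.range t, α ^ j ^ 3 * aeval α (b j) + α ^ t ^ 3 * s α)) := by
  classical
  have hT0 : 0 ≤ T := (norm_nonneg _).trans (hT 0)
  -- The choice is made total in `w`: the recursion must be defined before its residuals are known
  -- to be symmetric.
  have hK' : ∀ j, ∀ w : ℂ → ℂ, ∃ b : ℤ[X], (∀ α ∈ E j, w (conj α) = conj (w α)) →
      (∀ i, (E j).card ≤ i → b.coeff i = 0) ∧
        (∀ α ∈ E j, ‖w α - aeval α b‖ ≤ (E j).card) ∧
        ∀ M, 0 ≤ M → (∀ α ∈ E j, ‖w α‖ ≤ M) → ∀ i, |((b.coeff i : ℤ) : ℝ)| ≤ K j * M + 1 := by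
    intro j w
    by_cases hw : ∀ α ∈ E j, w (conj α) = conj (w α)
    · obtain ⟨b, hb⟩ := (hK j).2 w hw
      exact ⟨b, fun _ => hb⟩
    · exact ⟨0, fun h => absurd h hw⟩
  choose B hB using hK'
  -- the residual with the points entering at time `j` initialised
  let fresh : ℕ → (ℂ → ℂ) → ℂ → ℂ := fun j v α =>
    if α ∈ E j ∧ ∀ i < j, α ∉ E i then α ^ j ^ 3 * s α else v α
  let poly : ℕ → (ℂ → ℂ) → ℤ[X] := fun j v =>
    B j (fun α => fresh j v α / α ^ j ^ 3) + monomial j (e j)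
  let v : ℕ → ℂ → ℂ := fun j => Nat.rec (fun _ => 0)
    (fun j v α => fresh j v α - α ^ j ^ 3 * aeval α (poly j v)) j
  let b : ℕ → ℤ[X] := fun j => poly j (v j)
  have hv : ∀ j α, v (j + 1) α = fresh j (v j) α - α ^ j ^ 3 * aeval α (b j) := fun _ _ => rfl
  have hEc : ∀ j α, conj α ∈ E j ↔ α ∈ E j := fun j α =>
    ⟨fun h => by simpa using hconj j _ h, hconj j α⟩
  have haec : ∀ (q : ℤ[X]) (α : ℂ), aeval (conj α) q = conj (aeval α q) := by
    intro q α
    simp [aeval_eq_sum_range, map_sum]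
  have hfresh_symm : ∀ j, (∀ α, v j (conj α) = conj (v j α)) →
      ∀ α, fresh j (v j) (conj α) = conj (fresh j (v j) α) := by
    intro j h α
    simp only [fresh, hEc, h, hs]
    split_ifs <;> simp
  have hsymm : ∀ j α, v j (conj α) = conj (v j α) := by
    intro j
    induction j with
    | zero => intro α; simp [v]
    | succ j ih =>
      intro α
      rw [hv, hv, hfresh_symm j ih, haec, map_sub, map_mul, map_pow]
  have hw : ∀ j, ∀ α ∈ E j, fresh j (v j) (conj α) / (conj α) ^ j ^ 3
      = conj (fresh j (v j) α / α ^ j ^ 3) := by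
    intro j α _
    rw [hfresh_symm j (hsymm j), map_div₀, map_pow]
  have hBj := fun j => hB j (fun α => fresh j (v j) α / α ^ j ^ 3) (hw j)
  -- The rounding error contributes `j`, the extra monomial `e j * α ^ j` contributes `1`.
  have hbound : ∀ j, ∀ α ∈ E j, ‖v (j + 1) α‖ ≤ (j + 1) * ‖α‖ ^ j ^ 3 := by
    intro j α hα
    have hα0 : α ^ j ^ 3 ≠ 0 := pow_ne_zero _ (hE j α hα).1
    have h1 := (hBj j).2.1 α hα
    have h2 : v (j + 1) α = α ^ j ^ 3 * ((fresh j (v j) α / α ^ j ^ 3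
        - aeval α (B j (fun α => fresh j (v j) α / α ^ j ^ 3))) - e j * α ^ j) := by
      rw [hv]
      simp only [b, poly, map_add, aeval_monomial]
      field_simp
      simp
      ring
    rw [h2, norm_mul, norm_pow, mul_comm]
    refine mul_le_mul_of_nonneg_right ((norm_sub_le _ _).trans (add_le_add (h1.trans ?_) ?_))
      (by positivity)
    · exact_mod_cast hcard j
    · rw [norm_mul, norm_pow]
      have h3 : ‖α‖ ^ j ≤ 1 := pow_le_one₀ (norm_nonneg _) (hE j α hα).2.le
      rcases he j with h | h <;> simp [h, h3]
  have hcoeff : ∀ j i, (b j).coeff i = (B j (fun α => fresh j (v j) α / α ^ j ^ 3)).coeff i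
      + if j = i then e j else 0 := by
    intro j i
    simp [b, poly, coeff_monomial]
  have hfb : ∀ j, ∀ R : ℝ, 1 ≤ R → (∀ α ∈ E j, 1 ≤ R * ‖α‖) → ∀ α ∈ E j,
      ‖fresh j (v j) α / α ^ j ^ 3‖ ≤ T + j * R ^ (3 * j ^ 2) := by
    intro j R hR hRE α hα
    have hα0 : 0 < ‖α‖ ^ j ^ 3 := pow_pos (norm_pos_iff.2 (hE j α hα).1) _
    rw [norm_div, norm_pow, div_le_iff₀ hα0]
    have hR0 : 0 ≤ R := zero_le_one.trans hR
    by_cases hnew : ∀ i < j, α ∉ E i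
    · simp only [fresh, hα, true_and, if_pos hnew]
      rw [norm_mul, norm_pow, mul_comm]
      refine mul_le_mul_of_nonneg_right ((hT α).trans ?_) hα0.le
      have : 0 ≤ (j : ℝ) * R ^ (3 * j ^ 2) := by positivity
      linarith
    · obtain _ | k := j
      · simp [h0] at hα
      have hold : α ∈ E k := by
        push Not at hnew
        obtain ⟨i, hi, hαi⟩ := hnew
        exact hmono (Nat.lt_succ_iff.1 hi) hαi
      simp only [fresh, hα, true_and, if_neg hnew]
      refine (hbound k α hold).trans ?_
      -- The gap `(k + 1) ^ 3 - k ^ 3 = 3 * k ^ 2 + 3 * k + 1` is at most `3 * (k + 1) ^ 2`.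
      have h1 : 1 ≤ R ^ (3 * (k + 1) ^ 2) * ‖α‖ ^ (3 * k ^ 2 + 3 * k + 1) := by
        calc (1 : ℝ) ≤ (R * ‖α‖) ^ (3 * k ^ 2 + 3 * k + 1) := one_le_pow₀ (hRE α hα)
          _ = R ^ (3 * k ^ 2 + 3 * k + 1) * ‖α‖ ^ (3 * k ^ 2 + 3 * k + 1) := mul_pow _ _ _
          _ ≤ _ := by
            refine mul_le_mul_of_nonneg_right (pow_le_pow_right₀ hR ?_) (by positivity)
            nlinarith
      have h2 : ‖α‖ ^ (k + 1) ^ 3 = ‖α‖ ^ k ^ 3 * ‖α‖ ^ (3 * k ^ 2 + 3 * k + 1) := by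
        rw [← pow_add]; congr 1; ring
      rw [h2]
      have h3 : 0 ≤ ((k : ℝ) + 1) * ‖α‖ ^ k ^ 3 := by positivity
      have h4 : 0 ≤ T * (‖α‖ ^ k ^ 3 * ‖α‖ ^ (3 * k ^ 2 + 3 * k + 1)) := by positivity
      have h5 := mul_le_mul_of_nonneg_left h1 h3
      push_cast
      nlinarith
  refine ⟨b, fun j i hi => ?_, fun j => ?_, fun j R hR hRE i => ?_, fun α t hαt hnew => ?_⟩
  · rw [hcoeff, (hBj j).1 i ((hcard j).trans hi.le), if_neg hi.ne, add_zero]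
  · rw [hcoeff, (hBj j).1 j (hcard j), if_pos rfl, zero_add]
  · have hM : 0 ≤ T + j * R ^ (3 * j ^ 2) := by positivity
    rw [hcoeff]
    split_ifs with hij
    · subst hij
      rw [(hBj j).1 j (hcard j), zero_add]
      have := mul_nonneg (hK j).1 hM
      rcases he j with h | h <;> simp only [h, Int.cast_zero, Int.cast_one, abs_zero, abs_one] <;> linarith
    · rw [add_zero]
      exact (hBj j).2.2 _ hM (hfb j R hR hRE) i
  · have hmem : ∀ k, α ∈ E (t + k) := fun k => hmono (Nat.le_add_right _ _) hαt
    have hsum : ∀ k, ∑ j ∈ Finset.range (t + (k + 1)), α ^ j ^ 3 * aeval α (b j)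
        = ∑ j ∈ Finset.range t, α ^ j ^ 3 * aeval α (b j) + α ^ t ^ 3 * s α
          - v (t + k + 1) α := by
      intro k
      induction k with
      | zero =>
        rw [zero_add, Finset.sum_range_succ, add_zero, hv]
        simp only [fresh, hαt, true_and, if_pos hnew]
        ring
      | succ k ih =>
        rw [show t + (k + 1 + 1) = t + (k + 1) + 1 by ring, Finset.sum_range_succ, ih,
          show t + (k + 1) + 1 = (t + k + 1) + 1 by ring, hv (t + k + 1)]
        have : ¬ ∀ i < t + k + 1, α ∉ E i := fun h => h (t + k) (by omega) (hmem k)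
        simp only [fresh, this, and_false, if_false, ← add_assoc]
        ring
    have hv0 : Tendsto (fun k => v (t + k + 1) α) atTop (𝓝 0) := by
      have h1 : Tendsto (fun n : ℕ => ((n : ℝ) + 1) * ‖α‖ ^ n) atTop (𝓝 0) := by
        have ha := tendsto_self_mul_const_pow_of_lt_one (norm_nonneg α) (hE t α hαt).2
        have hb := tendsto_pow_atTop_nhds_zero_of_lt_one (norm_nonneg α) (hE t α hαt).2
        simpa [add_mul] using ha.add hb
      have h2 := h1.comp (tendsto_add_atTop_nat t)
      refine squeeze_zero_norm (fun k => ?_) h2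
      refine (hbound _ α (hmem k)).trans ?_
      simp only [Function.comp, add_comm k t]
      refine mul_le_mul_of_nonneg_left ?_ (by positivity)
      exact pow_le_pow_of_le_one (norm_nonneg _) (hE t α hαt).2.le (Nat.le_self_pow (by norm_num) _)
    rw [← tendsto_add_atTop_iff_nat (t + 1)]
    have := (tendsto_const_nhds (x := ∑ j ∈ Finset.range t, α ^ j ^ 3 * aeval α (b j)
      + α ^ t ^ 3 * s α)).sub hv0
    rw [sub_zero] at this
    refine this.congr fun k => ?_
    rw [← hsum k]
    congr 2
    ring

/-- A slowly growing unbounded monotone sequence satisfying eventually valid constraints. -/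
theorem exists_monotone_tendsto_of_eventually (p : ℕ → ℕ → Prop) (h0 : ∀ j, p 0 j)
    (h : ∀ n, ∀ᶠ j in atTop, p n j) :
    ∃ ν : ℕ → ℕ, Monotone ν ∧ Tendsto ν atTop atTop ∧ ν 0 = 0 ∧ ∀ j, p (ν j) j := by
  classical
  -- Requiring `p n i` for all `i ≥ j`, not just at `j`, makes the choice monotone.
  refine ⟨fun j => Nat.findGreatest (fun n => ∀ i, j ≤ i → p n i) j, fun j k hjk => ?_, ?_, ?_,
    fun j => ?_⟩
  · exact Nat.findGreatest_mono (fun n hn i hi => hn i (hjk.trans hi)) hjk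
  · refine tendsto_atTop.2 fun n => ?_
    obtain ⟨J, hJ⟩ := eventually_atTop.1 (h n)
    filter_upwards [eventually_ge_atTop (max J n)] with j hj
    exact Nat.le_findGreatest ((le_max_right _ _).trans hj)
      fun i hi => hJ i (((le_max_left _ _).trans hj).trans hi)
  · simp
  · exact Nat.findGreatest_spec (P := fun n => ∀ i, j ≤ i → p n i) (Nat.zero_le j)
      (fun i _ => h0 i) j le_rfl

/-! ### Countability of the non-transcendental members of `ℤ{z}`. -/

section Transcendence

open Polynomial

theorem eq_zero_of_hasSum_zero (G : PowerSeries ℂ)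
    (h : ∀ z : ℂ, ‖z‖ < 1 → HasSum (fun n => PowerSeries.coeff n G * z ^ n) 0) : G = 0 := by
  have h1 : HasFPowerSeriesOnBall (fun _ : ℂ => (0 : ℂ))
      (FormalMultilinearSeries.ofScalars ℂ (fun n => PowerSeries.coeff n G)) 0 1 := by
    refine ⟨?_, by norm_num, fun {y} hy => ?_⟩
    · refine ENNReal.le_of_forall_nnreal_lt fun r hr => ?_
      have hr1 : r < 1 := by exact_mod_cast hr
      have := (h (r : ℂ) (by simpa using hr1)).summable.tendsto_atTop_zero
      refine FormalMultilinearSeries.le_radius_of_tendsto _ (l := 0) ?_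
      have h2 := this.norm
      simpa [FormalMultilinearSeries.ofScalars_norm] using h2
    · have hy' : ‖y‖ < 1 := by
        simpa [enorm_eq_nnnorm, ← NNReal.coe_lt_coe] using hy
      simpa [FormalMultilinearSeries.ofScalars_apply_eq, smul_eq_mul, mul_comm] using h y hy'
  have h2 := h1.hasFPowerSeriesAt.eq_zero
  ext n
  have h3 := congrArg (fun p => p.coeff n) h2
  simp only [FormalMultilinearSeries.coeff_ofScalars] at h3
  rw [h3]
  rfl

/-- Absolute summation at `z` with prescribed sum. -/
def SumsTo (G : PowerSeries ℂ) (z a : ℂ) : Prop :=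
  Summable (fun n => ‖PowerSeries.coeff n G * z ^ n‖) ∧
    ∑' n, PowerSeries.coeff n G * z ^ n = a

theorem SumsTo.mul {G H : PowerSeries ℂ} {z a b : ℂ} (hG : SumsTo G z a) (hH : SumsTo H z b) :
    SumsTo (G * H) z (a * b) := by
  have key : ∀ n, PowerSeries.coeff n (G * H) * z ^ n = ∑ kl ∈ Finset.HasAntidiagonal.antidiagonal n,
      (PowerSeries.coeff kl.1 G * z ^ kl.1) * (PowerSeries.coeff kl.2 H * z ^ kl.2) := by
    intro n
    rw [PowerSeries.coeff_mul, Finset.sum_mul]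
    refine Finset.sum_congr rfl fun kl hkl => ?_
    rw [← Finset.HasAntidiagonal.mem_antidiagonal.1 hkl, pow_add]; ring
  refine ⟨?_, ?_⟩
  · simp_rw [key]
    exact summable_norm_sum_mul_antidiagonal_of_summable_norm
      (f := fun n => PowerSeries.coeff n G * z ^ n) (g := fun n => PowerSeries.coeff n H * z ^ n)
      hG.1 hH.1
  · have h := tsum_mul_tsum_eq_tsum_sum_antidiagonal_of_summable_norm
      (f := fun n => PowerSeries.coeff n G * z ^ n) (g := fun n => PowerSeries.coeff n H * z ^ n)
      hG.1 hH.1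
    rw [hG.2, hH.2] at h
    rw [h]
    exact tsum_congr key

theorem SumsTo.add {G H : PowerSeries ℂ} {z a b : ℂ} (hG : SumsTo G z a) (hH : SumsTo H z b) :
    SumsTo (G + H) z (a + b) := by
  have key : ∀ n, PowerSeries.coeff n (G + H) * z ^ n
      = PowerSeries.coeff n G * z ^ n + PowerSeries.coeff n H * z ^ n := by
    intro n; rw [map_add, add_mul]
  refine ⟨?_, ?_⟩
  · simp_rw [key]
    exact (hG.1.add hH.1).of_nonneg_of_le (fun _ => norm_nonneg _) fun _ => norm_add_le _ _
  · simp_rw [key]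
    rw [← hG.2, ← hH.2]
    exact hG.1.of_norm.tsum_add hH.1.of_norm

theorem SumsTo.coe (p : ℂ[X]) (z : ℂ) : SumsTo (p : PowerSeries ℂ) z (p.eval z) := by
  have h : ∀ n ∉ Finset.range (p.natDegree + 1),
      PowerSeries.coeff n (p : PowerSeries ℂ) * z ^ n = 0 := by
    intro n hn
    rw [Polynomial.coeff_coe, coeff_eq_zero_of_natDegree_lt, zero_mul]
    simpa [Nat.lt_succ_iff] using hn
  refine ⟨summable_of_ne_finset_zero (s := Finset.range (p.natDegree + 1))
    fun n hn => by rw [h n hn, norm_zero], ?_⟩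
  rw [tsum_eq_sum h, eval_eq_sum_range]
  simp [Polynomial.coeff_coe]

theorem SumsTo.pow {G : PowerSeries ℂ} {z a : ℂ} (hG : SumsTo G z a) (n : ℕ) :
    SumsTo (G ^ n) z (a ^ n) := by
  induction n with
  | zero => simpa using SumsTo.coe 1 z
  | succ n ih => rw [pow_succ, pow_succ]; exact ih.mul hG

theorem SumsTo.eval₂ {G : PowerSeries ℂ} {z a : ℂ} (hG : SumsTo G z a) (Q : ℂ[X][X]) :
    SumsTo (Q.eval₂ (coeToPowerSeries.ringHom (R := ℂ)) G) z (Q.evalEval z a) := by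
  induction Q using Polynomial.induction_on' with
  | add p q hp hq => rw [eval₂_add, evalEval_add]; exact hp.add hq
  | monomial n p =>
    rw [eval₂_monomial, evalEval, eval_monomial, eval_mul, eval_pow, eval_C]
    exact (SumsTo.coe p z).mul (hG.pow n)

theorem sumsTo_value {f : PowerSeries ℤ} (hf : f ∈ IntegerAnalytic) {z : ℂ} (hz : ‖z‖ < 1) :
    SumsTo (f.map (Int.castRingHom ℂ)) z (value f z) := by
  have h := hf z (by simpa using hz)
  refine ⟨?_, ?_⟩
  · simpa [term, norm_mul] using h.norm
  · simp [value, term]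

/-- A power series with integer coefficients that is not a transcendental function is algebraic
over `ℚ[X]`. -/
theorem isAlgebraic_of_not_isTranscendentalFunction {f : PowerSeries ℤ}
    (hf : f ∈ IntegerAnalytic) (h : ¬ IsTranscendentalFunction f) :
    IsAlgebraic ℚ[X] (f.map (Int.castRingHom ℚ)) := by
  rw [IsTranscendentalFunction] at h
  push Not at h
  obtain ⟨Q, hQ, hQ0⟩ := h
  set F := f.map (Int.castRingHom ℂ) with hF
  set f' := f.map (Int.castRingHom ℚ) with hf'
  have hG : Q.eval₂ (coeToPowerSeries.ringHom (R := ℂ)) F = 0 := by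
    refine eq_zero_of_hasSum_zero _ fun z hz => ?_
    have h1 := (sumsTo_value hf hz).eval₂ Q
    rw [hQ z (by simpa using hz)] at h1
    have h2 := h1.1.of_norm.hasSum
    rwa [h1.2] at h2
  obtain ⟨j₀, hj₀⟩ : ∃ j, Q.coeff j ≠ 0 := by
    by_contra! hc
    exact hQ0 (Polynomial.ext fun j => by simpa using hc j)
  obtain ⟨i₀, hi₀⟩ : ∃ i, (Q.coeff j₀).coeff i ≠ 0 := by
    by_contra! hc
    exact hj₀ (Polynomial.ext fun j => by simpa using hc j)
  -- Powers of `f` have rational coefficients, so a `ℚ`-linear functional applied to the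
  -- coefficients of `Q` preserves the relation; choosing it nonzero on one coefficient keeps it
  -- nontrivial.
  obtain ⟨l, hl⟩ : ∃ l : ℂ →ₗ[ℚ] ℚ, l ((Q.coeff j₀).coeff i₀) ≠ 0 := by
    by_contra! hc
    exact hi₀ ((Module.forall_dual_apply_eq_zero_iff ℚ _).1 hc)
  let lx : ℂ[X] → ℚ[X] := fun p => ∑ i ∈ p.support, monomial i (l (p.coeff i))
  have hlx : ∀ p i, (lx p).coeff i = l (p.coeff i) := by
    intro p i
    simp only [lx, finsetSum_coeff, coeff_monomial, Finset.sum_ite_eq', mem_support_iff]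
    split_ifs with h
    · rfl
    · simp only [ne_eq, not_not] at h; simp [h]
  let Q' : ℚ[X][X] := ∑ j ∈ Q.support, monomial j (lx (Q.coeff j))
  have hQ' : ∀ j, Q'.coeff j = lx (Q.coeff j) := by
    intro j
    simp only [Q', finsetSum_coeff, coeff_monomial, Finset.sum_ite_eq', mem_support_iff]
    split_ifs with h
    · rfl
    · simp only [ne_eq, not_not] at h; simp [h, lx]
  refine ⟨Q', fun h => hl ?_, ?_⟩
  · rw [← hlx, ← hQ', h]; simp
  · have hpow : ∀ j n, PowerSeries.coeff n (F ^ j) = ((PowerSeries.coeff n (f' ^ j) : ℚ) : ℂ) := by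
      intro j n
      rw [hF, hf', ← map_pow, ← map_pow, PowerSeries.coeff_map, PowerSeries.coeff_map]
      simp
    ext n
    have h1 := congrArg (fun g => l (PowerSeries.coeff n g)) hG
    simp only [eval₂_eq_sum, Polynomial.sum, map_sum, map_zero] at h1
    simp only [Q', map_sum (aeval f'), aeval_monomial, map_sum (PowerSeries.coeff n), map_zero]
    rw [← h1]
    refine Finset.sum_congr rfl fun j _ => ?_
    rw [PowerSeries.coeff_mul, PowerSeries.coeff_mul, map_sum l]
    refine Finset.sum_congr rfl fun kl _ => ?_
    rw [hpow, PowerSeries.algebraMap_apply']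
    simp only [coeToPowerSeries.ringHom_apply, Polynomial.coeff_coe]
    rw [mul_comm ((Q.coeff j).coeff kl.1), ← Rat.smul_def, map_smul, smul_eq_mul, mul_comm]
    simp [hlx]

/-- Only countably many elements of `ℤ{z}` fail to be transcendental functions. -/
theorem countable_not_isTranscendentalFunction :
    {f : PowerSeries ℤ | f ∈ IntegerAnalytic ∧ ¬ IsTranscendentalFunction f}.Countable := by
  have : Module.IsTorsionFree ℚ[X] (PowerSeries ℚ) :=
    Module.isTorsionFree_iff_algebraMap_injective.2 fun p q h => by
      simpa [PowerSeries.algebraMap_apply'] using h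
  have : Countable ℚ[X] := Cardinal.mk_le_aleph0_iff.1 <|
    Polynomial.cardinalMk_le_max.trans (max_le Cardinal.mk_le_aleph0 le_rfl)
  have h1 : {x : PowerSeries ℚ | IsAlgebraic ℚ[X] x}.Countable := Algebraic.countable _ _
  have hinj : Function.Injective (PowerSeries.map (Int.castRingHom ℚ)) :=
    PowerSeries.map_injective _ Int.cast_injective
  exact (h1.preimage hinj).mono fun f hf =>
    isAlgebraic_of_not_isTranscendentalFunction hf.1 hf.2

end Transcendence

/-! ### Slow exhaustion of the algebraic points. -/

theorem exists_quadratic_exponent_bound {K T R : ℝ} (hK : 0 ≤ K) (hT : 0 ≤ T) (hR : 1 ≤ R) :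
    ∃ Q : ℝ, ∀ j : ℕ, 1 ≤ j → K * (T + j * R ^ (3 * j ^ 2)) + 1 ≤ Q ^ j ^ 2 := by
  refine ⟨(K * (T + 1) + 1) * (2 * R ^ 3), fun j hj => ?_⟩
  have h1 : (j : ℝ) ≤ 2 ^ j ^ 2 := by
    have : j ≤ 2 ^ j ^ 2 :=
      (Nat.le_self_pow (by norm_num) j).trans Nat.lt_two_pow_self.le
    exact_mod_cast this
  have h2 : 1 ≤ K * (T + 1) + 1 := by nlinarith [mul_nonneg hK (by linarith : 0 ≤ T + 1)]
  have h3 : 1 ≤ (2 * R ^ 3) ^ j ^ 2 := one_le_pow₀ (by nlinarith [one_le_pow₀ hR (n := 3)])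
  have h4 : (j : ℝ) * R ^ (3 * j ^ 2) ≤ (2 * R ^ 3) ^ j ^ 2 := by
    rw [mul_pow, ← pow_mul]
    exact mul_le_mul_of_nonneg_right h1 (by positivity)
  calc K * (T + j * R ^ (3 * j ^ 2)) + 1
      ≤ K * (T * (2 * R ^ 3) ^ j ^ 2 + (2 * R ^ 3) ^ j ^ 2) + (2 * R ^ 3) ^ j ^ 2 := by
        refine add_le_add (mul_le_mul_of_nonneg_left (add_le_add ?_ h4) hK) h3
        exact le_mul_of_one_le_right hT h3
    _ = (K * (T + 1) + 1) * (2 * R ^ 3) ^ j ^ 2 := by ring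
    _ ≤ (K * (T + 1) + 1) ^ j ^ 2 * (2 * R ^ 3) ^ j ^ 2 := by
        refine mul_le_mul_of_nonneg_right (le_self_pow₀ h2 ?_) (by linarith)
        positivity
    _ = _ := (mul_pow _ _ _).symm

/-- A slow exhaustion of a countable, conjugation-stable subset of the punctured unit disc. -/
theorem exists_exhaustion {A : Set ℂ} (hA : A.Countable) (hne : A.Nonempty)
    (hconj : ∀ α ∈ A, conj α ∈ A) (hdisc : ∀ α ∈ A, α ≠ 0 ∧ ‖α‖ < 1) {T : ℝ} (hT : 0 ≤ T) :
    ∃ (E : ℕ → Finset ℂ) (K : ℕ → ℝ), Monotone E ∧ E 0 = ∅ ∧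
      (∀ j, ∀ α ∈ E j, conj α ∈ E j) ∧ (∀ j, ∀ α ∈ E j, α ∈ A) ∧ (∀ α ∈ A, ∃ j, α ∈ E j) ∧
      (∀ j, (E j).card ≤ j) ∧ (∀ j, ApproximationBound (E j) (K j)) ∧
      ∀ ρ : ℝ, 1 < ρ → ∀ᶠ j in atTop, ∃ R : ℝ, 1 ≤ R ∧ (∀ α ∈ E j, 1 ≤ R * ‖α‖) ∧
        K j * (T + j * R ^ (3 * j ^ 2)) + 1 ≤ ρ ^ j ^ 3 := by
  classical
  obtain ⟨a, ha⟩ := hA.exists_eq_range hne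
  let F : ℕ → Finset ℂ := fun n =>
    (Finset.range n).image a ∪ (Finset.range n).image (fun i => conj (a i))
  have hF : ∀ n α, α ∈ F n ↔ ∃ i < n, a i = α ∨ conj (a i) = α := by
    intro n α
    simp only [F, Finset.mem_union, Finset.mem_image, Finset.mem_range, ← exists_or, and_or_left]
  have haA : ∀ i, a i ∈ A := fun i => ha ▸ Set.mem_range_self i
  have hFA : ∀ n, ∀ α ∈ F n, α ∈ A := by
    intro n α hα
    obtain ⟨i, -, rfl | rfl⟩ := (hF n α).1 hα
    · exact haA i
    · exact hconj _ (haA i)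
  have hFc : ∀ n, ∀ α ∈ F n, conj α ∈ F n := by
    intro n α hα
    obtain ⟨i, hi, rfl | rfl⟩ := (hF n α).1 hα
    · exact (hF _ _).2 ⟨i, hi, Or.inr rfl⟩
    · exact (hF _ _).2 ⟨i, hi, Or.inl (by simp)⟩
  have hFm : Monotone F := by
    intro m n hmn α hα
    obtain ⟨i, hi, h⟩ := (hF m α).1 hα
    exact (hF _ _).2 ⟨i, hi.trans_le hmn, h⟩
  have hF0 : F 0 = ∅ := by simp [F]
  choose K hK using fun n =>
    exists_integer_approximation (F n) (fun α hα => (hdisc α (hFA n α hα)).2.le) (hFc n)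
  have hR : ∀ n, ∃ R : ℝ, 1 ≤ R ∧ ∀ α ∈ F n, 1 ≤ R * ‖α‖ := by
    intro n
    refine ⟨1 + ∑ α ∈ F n, ‖α‖⁻¹, ?_, fun α hα => ?_⟩
    · linarith [Finset.sum_nonneg fun (α : ℂ) (_ : α ∈ F n) => inv_nonneg.2 (norm_nonneg α)]
    · have h1 : ‖α‖⁻¹ ≤ 1 + ∑ α ∈ F n, ‖α‖⁻¹ :=
        (Finset.single_le_sum (f := fun α : ℂ => ‖α‖⁻¹)
          (fun β _ => inv_nonneg.2 (norm_nonneg β)) hα).trans (by linarith)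
      have h2 : 0 < ‖α‖ := norm_pos_iff.2 (hdisc α (hFA n α hα)).1
      calc (1 : ℝ) = ‖α‖⁻¹ * ‖α‖ := (inv_mul_cancel₀ h2.ne').symm
        _ ≤ _ := mul_le_mul_of_nonneg_right h1 h2.le
  choose R hR1 hR using hR
  choose Q hQ using fun n => exists_quadratic_exponent_bound (hK n).1 hT (hR1 n)
  have hone : ∀ n : ℕ, (1 : ℝ) < 1 + 1 / (n + 1) := fun n => by
    have : (0 : ℝ) < 1 / (n + 1) := Nat.one_div_pos_of_nat
    linarith
  -- Level `n ≥ 1` is used only once `Q n ≤ (1 + 1 / (n + 1)) ^ j`, which turns `Q n ^ j ^ 2` into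
  -- `(1 + 1 / (n + 1)) ^ j ^ 3`. Level `0`, where `F 0` is empty, is always allowed.
  obtain ⟨ν, hνm, hνt, hν0, hν⟩ := exists_monotone_tendsto_of_eventually
    (fun n j => n = 0 ∨ (1 ≤ j ∧ (F n).card ≤ j ∧ Q n ≤ (1 + 1 / ((n : ℝ) + 1)) ^ j))
    (fun j => Or.inl rfl) (fun n => by
      filter_upwards [eventually_ge_atTop 1, eventually_ge_atTop (F n).card,
        (tendsto_pow_atTop_atTop_of_one_lt (hone n)).eventually_ge_atTop (Q n)] with j h1 h2 h3
      exact Or.inr ⟨h1, h2, h3⟩)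
  refine ⟨fun j => F (ν j), fun j => K (ν j), hFm.comp hνm, by simp [hν0, hF0],
    fun j => hFc _, fun j => hFA _, fun α hα => ?_, fun j => ?_, fun j => hK _, fun ρ hρ => ?_⟩
  · rw [ha] at hα
    obtain ⟨i, rfl⟩ := hα
    obtain ⟨j, hj⟩ := (hνt.eventually_gt_atTop i).exists
    exact ⟨j, (hF _ _).2 ⟨i, hj, Or.inl rfl⟩⟩
  · rcases hν j with h | h
    · simp [h, hF0]
    · exact h.2.1
  · have hlim : Tendsto (fun j => 1 + 1 / ((ν j : ℝ) + 1)) atTop (𝓝 (1 + 0)) :=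
      tendsto_const_nhds.add (tendsto_one_div_add_atTop_nhds_zero_nat.comp hνt)
    rw [add_zero] at hlim
    filter_upwards [hlim.eventually_le_const hρ, hνt.eventually_ge_atTop 1] with j hj hj1
    obtain h | ⟨h1, -, h3⟩ := hν j
    · omega
    refine ⟨R (ν j), hR1 _, hR _, (hQ (ν j) j h1).trans ?_⟩
    have hQ0 : 0 ≤ Q (ν j) := by
      have := hQ (ν j) 1 le_rfl
      have h5 : 0 ≤ K (ν j) * (T + (1 : ℕ) * R (ν j) ^ (3 * 1 ^ 2)) := by
        have := (hK (ν j)).1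
        have := zero_le_one.trans (hR1 (ν j))
        positivity
      simp only [one_pow, pow_one] at this h5
      linarith
    calc Q (ν j) ^ j ^ 2 ≤ ((1 + 1 / ((ν j : ℝ) + 1)) ^ j) ^ j ^ 2 := pow_le_pow_left₀ hQ0 h3 _
      _ = (1 + 1 / ((ν j : ℝ) + 1)) ^ j ^ 3 := by rw [← pow_mul]; congr 1; ring
      _ ≤ ρ ^ j ^ 3 := pow_le_pow_left₀ (zero_le_one.trans (hone _).le) hj _

/-! ### Series supported near cubes: convergence and density. -/

open Polynomial in
/-- The power series `∑ X ^ j ^ 3 * b j` for polynomials `b j` of degree at most `j`. -/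
theorem exists_powerSeries_of_blocks (b : ℕ → ℤ[X]) (hb : ∀ j i, j < i → (b j).coeff i = 0) :
    ∃ ψ : PowerSeries ℤ, (∀ j i, i ≤ j → PowerSeries.coeff (j ^ 3 + i) ψ = (b j).coeff i) ∧
      (∀ k, PowerSeries.coeff k ψ ≠ 0 → ∃ j i, i ≤ j ∧ k = j ^ 3 + i) ∧
      ∀ z J, ∑ k ∈ Finset.range (J ^ 3), term ψ z k
        = ∑ j ∈ Finset.range J, z ^ j ^ 3 * aeval z (b j) := by
  -- The integer cube root of `k`, naming the block that contains the index `k`.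
  let r : ℕ → ℕ := fun k => Nat.findGreatest (fun j => j ^ 3 ≤ k) k
  have hr : ∀ k, r k ^ 3 ≤ k := fun k =>
    Nat.findGreatest_spec (P := fun j => j ^ 3 ≤ k) (Nat.zero_le k) (by simp)
  have hrj : ∀ j i, j ^ 3 + i < (j + 1) ^ 3 → r (j ^ 3 + i) = j := by
    intro j i hi
    refine le_antisymm ?_ ?_
    · have := (hr (j ^ 3 + i)).trans_lt hi
      exact Nat.lt_succ_iff.1 (lt_of_pow_lt_pow_left₀ 3 (Nat.zero_le _) this)
    · exact Nat.le_findGreatest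
        ((Nat.le_self_pow (by norm_num) j).trans (Nat.le_add_right _ _)) (Nat.le_add_right _ _)
  have hcube : ∀ j : ℕ, (j + 1) ^ 3 = j ^ 3 + (3 * j ^ 2 + 3 * j + 1) := fun j => by ring
  let ψ : PowerSeries ℤ := PowerSeries.mk fun k => (b (r k)).coeff (k - r k ^ 3)
  have hψ : ∀ j i, j ^ 3 + i < (j + 1) ^ 3 → PowerSeries.coeff (j ^ 3 + i) ψ = (b j).coeff i := by
    intro j i hi
    rw [PowerSeries.coeff_mk, hrj j i hi, Nat.add_sub_cancel_left]
  refine ⟨ψ, fun j i hi => hψ j i ?_, fun k hk => ?_, fun z J => ?_⟩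
  · rw [hcube]; nlinarith
  · refine ⟨r k, k - r k ^ 3, ?_, (Nat.add_sub_cancel' (hr k)).symm⟩
    by_contra! h
    exact hk (by rw [PowerSeries.coeff_mk, hb _ _ h])
  · induction J with
    | zero => simp
    | succ J ih =>
      rw [hcube, Finset.sum_range_add, ih, Finset.sum_range_succ _ J]
      congr 1
      have hdeg : (b J).natDegree < 3 * J ^ 2 + 3 * J + 1 := by
        have : (b J).natDegree ≤ J := natDegree_le_iff_coeff_eq_zero.2 fun i hi => hb J i hi
        nlinarith
      rw [aeval_eq_sum_range' hdeg, Finset.mul_sum]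
      refine Finset.sum_congr rfl fun i hi => ?_
      rw [term, hψ J i (by rw [hcube]; simpa using hi), pow_add, zsmul_eq_mul]
      ring

theorem mem_integerAnalytic_of_subexponential {ψ : PowerSeries ℤ}
    (h : ∀ ρ : ℝ, 1 < ρ → ∀ᶠ k in atTop, |((PowerSeries.coeff k ψ : ℤ) : ℝ)| ≤ ρ ^ k) :
    ψ ∈ IntegerAnalytic := by
  intro z hz
  have hz1 : ‖z‖ < 1 := by simpa using hz
  obtain ⟨r, hr1, hr2⟩ := exists_between hz1
  have hr0 : 0 < r := (norm_nonneg z).trans_lt hr1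
  by_cases hz0 : z = 0
  · subst hz0
    refine summable_of_ne_finset_zero (s := {0}) fun n hn => ?_
    simp only [Finset.mem_singleton] at hn
    simp [term, hn]
  have hzp : 0 < ‖z‖ := norm_pos_iff.2 hz0
  have hρ : 1 < r / ‖z‖ := (one_lt_div hzp).2 hr1
  refine Summable.of_norm_bounded_eventually_nat (summable_geometric_of_lt_one hr0.le hr2) ?_
  filter_upwards [h _ hρ] with k hk
  rw [term, norm_mul, norm_pow, Complex.norm_intCast]
  calc _ ≤ (r / ‖z‖) ^ k * ‖z‖ ^ k := mul_le_mul_of_nonneg_right hk (by positivity)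
    _ = r ^ k := by rw [← mul_pow, div_mul_cancel₀ _ hzp.ne']

/-- If the nonzero coefficients of `ψ` are supported on the intervals `[j ^ 3, j ^ 3 + j]`, then
the zero coefficients have natural density one. -/
theorem hasNaturalDensity_zeroIndices {ψ : PowerSeries ℤ}
    (h : ∀ k, PowerSeries.coeff k ψ ≠ 0 → ∃ j i, i ≤ j ∧ k = j ^ 3 + i) :
    HasNaturalDensity (zeroIndices ψ) 1 := by
  classical
  have hset : ∀ x : ℝ, 0 ≤ x → {n | n ∈ zeroIndices ψ ∧ (n : ℝ) ≤ x}
      = ((Finset.range (⌊x⌋₊ + 1)).filter (fun n => PowerSeries.coeff n ψ = 0) : Set ℕ) := by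
    intro x hx
    ext n
    simp only [zeroIndices, Set.mem_ofPred_eq, Finset.coe_filter, Finset.mem_range,
      Nat.lt_succ_iff, Nat.le_floor_iff hx]
    exact and_comm
  have hupper : ∀ x : ℝ, 0 ≤ x → (count (zeroIndices ψ) x : ℝ) ≤ x + 1 := by
    intro x hx
    rw [count, hset x hx, Set.ncard_coe_finset]
    refine le_trans (b := ((⌊x⌋₊ + 1 : ℕ) : ℝ)) ?_ ?_
    · exact_mod_cast (Finset.card_filter_le _ _).trans (Finset.card_range _).le
    · push_cast; linarith [Nat.floor_le hx]
  -- With `y = x ^ (1 / 3)`, a nonzero index up to `x` is given by a pair `(j, i)` with both entries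
  -- at most `y`, so there are at most `(2 * y) ^ 2` of them.
  have hlower : ∀ x : ℝ, 1 ≤ x →
      x - 4 * x ^ (2 / 3 : ℝ) ≤ (count (zeroIndices ψ) x : ℝ) := by
    intro x hx
    have hx0 : 0 ≤ x := zero_le_one.trans hx
    have hy1 : 1 ≤ x ^ (1 / 3 : ℝ) := Real.one_le_rpow hx (by norm_num)
    set y := x ^ (1 / 3 : ℝ) with hy
    have hy3 : y ^ 3 = x := by
      rw [hy, ← Real.rpow_natCast, ← Real.rpow_mul hx0]; norm_num
    have hy2 : y ^ 2 = x ^ (2 / 3 : ℝ) := by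
      rw [hy, ← Real.rpow_natCast, ← Real.rpow_mul hx0]; norm_num
    have hy0 : 0 ≤ y := zero_le_one.trans hy1
    rw [count, hset x hx0, Set.ncard_coe_finset]
    have hnon : ((Finset.range (⌊x⌋₊ + 1)).filter (fun n => ¬ PowerSeries.coeff n ψ = 0)).card
        ≤ (⌊y⌋₊ + 1) * (⌊y⌋₊ + 1) := by
      have hsub : (Finset.range (⌊x⌋₊ + 1)).filter (fun n => ¬ PowerSeries.coeff n ψ = 0)
          ⊆ (Finset.range (⌊y⌋₊ + 1) ×ˢ Finset.range (⌊y⌋₊ + 1)).image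
            (fun p => p.1 ^ 3 + p.2) := by
        intro k hk
        simp only [Finset.mem_filter, Finset.mem_range, Nat.lt_succ_iff, Nat.le_floor_iff hx0] at hk
        obtain ⟨j, i, hij, rfl⟩ := h k hk.2
        have hj : j ≤ ⌊y⌋₊ := by
          refine Nat.le_floor ?_
          have h1 : (j : ℝ) ^ 3 ≤ y ^ 3 := by
            rw [hy3]
            refine le_trans ?_ hk.1
            push_cast
            linarith [Nat.cast_nonneg (α := ℝ) i]
          exact le_of_pow_le_pow_left₀ (by norm_num) hy0 h1
        refine Finset.mem_image.2 ⟨(j, i), ?_, rfl⟩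
        simp only [Finset.mem_product, Finset.mem_range, Nat.lt_succ_iff]
        exact ⟨hj, hij.trans hj⟩
      refine (Finset.card_le_card hsub).trans (Finset.card_image_le.trans ?_)
      simp
    have hsum := Finset.card_filter_add_card_filter_not (s := Finset.range (⌊x⌋₊ + 1))
      (fun n => PowerSeries.coeff n ψ = 0)
    rw [Finset.card_range] at hsum
    have hsum' : (((Finset.range (⌊x⌋₊ + 1)).filter (fun n => PowerSeries.coeff n ψ = 0)).card : ℝ)
        + (((Finset.range (⌊x⌋₊ + 1)).filter (fun n => ¬ PowerSeries.coeff n ψ = 0)).card : ℝ)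
        = ⌊x⌋₊ + 1 := by exact_mod_cast hsum
    have hnon' : (((Finset.range (⌊x⌋₊ + 1)).filter
        (fun n => ¬ PowerSeries.coeff n ψ = 0)).card : ℝ) ≤ (⌊y⌋₊ + 1) * (⌊y⌋₊ + 1) := by
      exact_mod_cast hnon
    have hfl := Nat.floor_le hy0
    have hflx := (Nat.lt_floor_add_one x).le
    have : ((⌊y⌋₊ : ℝ) + 1) * (⌊y⌋₊ + 1) ≤ (2 * y) * (2 * y) :=
      mul_le_mul (by linarith) (by linarith) (by positivity) (by linarith)
    rw [← hy2]
    nlinarith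
  have hl : Tendsto (fun x : ℝ => 1 - 4 * x ^ (-(1 / 3) : ℝ)) atTop (𝓝 1) := by
    have := (tendsto_rpow_neg_atTop (y := 1 / 3) (by norm_num)).const_mul 4
    simpa using (tendsto_const_nhds (x := (1 : ℝ))).sub this
  have hu : Tendsto (fun x : ℝ => 1 + x⁻¹) atTop (𝓝 1) := by
    simpa using (tendsto_const_nhds (x := (1 : ℝ))).add tendsto_inv_atTop_zero
  refine tendsto_of_tendsto_of_tendsto_of_le_of_le' hl hu ?_ ?_
  · filter_upwards [eventually_ge_atTop 1] with x hx
    have hx0 : 0 < x := zero_lt_one.trans_le hx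
    rw [le_div_iff₀ hx0]
    refine le_trans (le_of_eq ?_) (hlower x hx)
    have : x ^ (2 / 3 : ℝ) = x ^ (-(1 / 3) : ℝ) * x := by
      nth_rewrite 3 [← Real.rpow_one x]
      rw [← Real.rpow_add hx0]; norm_num
    rw [this]; ring
  · filter_upwards [eventually_ge_atTop 1] with x hx
    have hx0 : 0 < x := zero_lt_one.trans_le hx
    rw [div_le_iff₀ hx0, add_mul, inv_mul_cancel₀ hx0.ne', one_mul]
    exact hupper x hx0.le

theorem lowerDensity_eq_of_hasNaturalDensity {A : Set ℕ} {d : ℝ} (h : HasNaturalDensity A d) :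
    lowerDensity A = d :=
  (h.comp tendsto_natCast_atTop_atTop).liminf_eq

/-! ### Prescribing the exceptional set and diagonalising. -/

theorem exists_real_transcendental : ∃ τ : ℝ, ¬ IsAlgebraic ℚ (τ : ℂ) := by
  refine ⟨liouvilleNumber (2 : ℕ), fun h => ?_⟩
  have h1 : IsAlgebraic ℤ ((liouvilleNumber (2 : ℕ) : ℝ) : ℂ) :=
    (IsFractionRing.isAlgebraic_iff ℤ ℚ ℂ).2 h
  exact transcendental_liouvilleNumber le_rfl
    ((isAlgebraic_algebraMap_iff (A := ℂ) (algebraMap ℝ ℂ).injective).1 h1)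

theorem isAlgebraic_conj {α : ℂ} (h : IsAlgebraic ℚ α) : IsAlgebraic ℚ (conj α) :=
  h.algHom (Complex.conjAe.toAlgHom.restrictScalars ℚ)

/-- Every conjugation-stable set of algebraic numbers in the unit disc containing `0` is the
exceptional set of a member of `ℤ{z}` with almost no nonzero coefficients, outside any given
countable family. -/
theorem exists_exceptionalSet_eq {S : Set ℂ}
    (hS : ∀ α ∈ S, IsAlgebraic ℚ α ∧ α ∈ Metric.ball (0 : ℂ) 1)
    (hconj : ∀ α ∈ S, conj α ∈ S) (h0 : (0 : ℂ) ∈ S) {C : Set (PowerSeries ℤ)}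
    (hC : C.Countable) :
    ∃ ψ ∈ IntegerAnalytic, exceptionalSet ψ = S ∧ HasNaturalDensity (zeroIndices ψ) 1 ∧ ψ ∉ C := by
  classical
  obtain ⟨φ, hφ⟩ : ∃ φ : ℕ → PowerSeries ℤ, C ⊆ Set.range φ :=
    Set.countable_iff_exists_subset_range.1 hC
  obtain ⟨τ, hτ⟩ := exists_real_transcendental
  let A : Set ℂ := {α | IsAlgebraic ℚ α ∧ ‖α‖ < 1 ∧ α ≠ 0}
  have hA : A.Countable := (Algebraic.countable ℚ ℂ).mono fun α h => h.1
  have hne : A.Nonempty := by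
    refine ⟨((2⁻¹ : ℚ) : ℂ), isAlgebraic_algebraMap (2⁻¹ : ℚ), ?_, by norm_num⟩
    norm_num
  obtain ⟨E, K, hEm, hE0, hEc, hEA, hAE, hcard, hK, hgrowth⟩ := exists_exhaustion hA hne
    (fun α h => ⟨isAlgebraic_conj h.1, by simpa using h.2.1, by simpa using h.2.2⟩)
    (fun α h => ⟨h.2.2, h.2.1⟩) (abs_nonneg τ)
  -- Since `τ` is real and `S` is conjugation-stable, `s` commutes with conjugation.
  let s : ℂ → ℂ := fun α => if α ∈ S then 0 else τ
  have hSc : ∀ α, conj α ∈ S ↔ α ∈ S := fun α =>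
    ⟨fun h => by simpa using hconj _ h, hconj α⟩
  obtain ⟨b, hbd, hbe, hbK, hbv⟩ := exists_blocks E hEm hE0 hEc
    (fun j α h => ⟨(hEA j α h).2.2, (hEA j α h).2.1⟩) hcard K hK s
    (fun α => by simp only [s, hSc]; split_ifs <;> simp) |τ|
    (fun α => by simp only [s]; split_ifs <;> simp)
    -- Diagonal choice: `ψ` differs from `φ j` at the index `j ^ 3 + j`.
    (fun j => if PowerSeries.coeff (j ^ 3 + j) (φ j) = 0 then 1 else 0)
    (fun j => by split_ifs <;> simp)
  obtain ⟨ψ, hψc, hψs, hψv⟩ := exists_powerSeries_of_blocks b hbd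
  have hψA : ψ ∈ IntegerAnalytic := by
    refine mem_integerAnalytic_of_subexponential fun ρ hρ => ?_
    obtain ⟨J, hJ⟩ := eventually_atTop.1 (hgrowth ρ hρ)
    filter_upwards [eventually_ge_atTop (J ^ 3 + J)] with k hk
    by_cases hk0 : PowerSeries.coeff k ψ = 0
    · rw [hk0]; simp only [Int.cast_zero, abs_zero]; positivity
    obtain ⟨j, i, hij, rfl⟩ := hψs k hk0
    have hJj : J ≤ j := by
      by_contra! hlt
      have : j ^ 3 ≤ J ^ 3 := Nat.pow_le_pow_left hlt.le 3
      omega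
    obtain ⟨R, hR1, hRE, hR⟩ := hJ j hJj
    rw [hψc j i hij]
    exact (hbK j R hR1 hRE i).trans (hR.trans (pow_le_pow_right₀ hρ.le (Nat.le_add_right _ _)))
  refine ⟨ψ, hψA, ?_, hasNaturalDensity_zeroIndices hψs, fun hψC => ?_⟩
  · have key : ∀ α ∈ A, (IsAlgebraic ℚ (value ψ α) ↔ α ∈ S) := by
      intro α hα
      have hex := hAE α hα
      have hlim := hbv α (Nat.find hex) (Nat.find_spec hex) fun i hi => Nat.find_min hex hi
      generalize Nat.find hex = t at hlim
      have hsum := (hψA α (by simpa using hα.2.1)).hasSum.tendsto_sum_nat.comp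
        (tendsto_pow_atTop (α := ℕ) (n := 3) (by norm_num))
      have hval : value ψ α = ∑ j ∈ Finset.range t, α ^ j ^ 3 * Polynomial.aeval α (b j)
          + α ^ t ^ 3 * s α :=
        tendsto_nhds_unique hsum (hlim.congr fun J => (hψv α J).symm)
      have hαi : α ∈ integralClosure ℚ ℂ := isAlgebraic_iff_isIntegral.1 hα.1
      have hPi : ∑ j ∈ Finset.range t, α ^ j ^ 3 * Polynomial.aeval α (b j)
          ∈ integralClosure ℚ ℂ := by
        refine sum_mem fun j _ => mul_mem (pow_mem hαi _) ?_
        rw [Polynomial.aeval_eq_sum_range]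
        exact sum_mem fun i _ => zsmul_mem (pow_mem hαi _) _
      have hP := isAlgebraic_iff_isIntegral.2 hPi
      rw [hval]
      by_cases hαS : α ∈ S
      · simpa [s, hαS] using hP
      · simp only [s, hαS, if_false, iff_false]
        intro h
        refine hτ ?_
        have h1 := (h.sub hP).mul (hα.1.pow (t ^ 3)).inv
        rwa [add_sub_cancel_left, mul_comm (α ^ t ^ 3), mul_assoc,
          mul_inv_cancel₀ (pow_ne_zero _ hα.2.2), mul_one] at h1
    ext α
    by_cases hα0 : α = 0
    · subst hα0
      refine iff_of_true ⟨isAlgebraic_zero, by simp, ?_⟩ h0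
      have : value ψ 0 = ((PowerSeries.coeff 0 ψ : ℤ) : ℂ) := by
        rw [value, tsum_eq_single 0 fun n hn => by simp [term, hn]]
        simp [term]
      rw [this]
      exact isAlgebraic_intCast _
    · constructor
      · rintro ⟨h1, h2, h3⟩
        exact (key α ⟨h1, by simpa using h2, hα0⟩).1 h3
      · intro h
        obtain ⟨h1, h2⟩ := hS α h
        exact ⟨h1, h2, (key α ⟨h1, by simpa using h2, hα0⟩).2 h⟩
  · obtain ⟨j, hj⟩ := hφ hψC
    have h1 := hψc j j le_rfl
    rw [hbe, ← hj] at h1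
    split_ifs at h1 with h2
    · omega
    · exact h2 h1

theorem not_countable_transcendental_exceptionalSet_eq {S : Set ℂ}
    (hS : ∀ α ∈ S, IsAlgebraic ℚ α ∧ α ∈ Metric.ball (0 : ℂ) 1)
    (hconj : ∀ α ∈ S, conj α ∈ S) (h0 : (0 : ℂ) ∈ S) :
    ¬ {ψ : PowerSeries ℤ | ψ ∈ IntegerAnalytic ∧ IsTranscendentalFunction ψ ∧
        exceptionalSet ψ = S ∧ HasNaturalDensity (zeroIndices ψ) 1}.Countable := by
  intro h
  -- Were the good series countable, one could avoid them together with all non-transcendental ones.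
  obtain ⟨ψ, h1, h2, h3, h4⟩ := exists_exceptionalSet_eq hS hconj h0
    (h.union countable_not_isTranscendentalFunction)
  by_cases hψ : IsTranscendentalFunction ψ
  · exact h4 (Or.inl ⟨h1, hψ, h2, h3⟩)
  · exact h4 (Or.inr ⟨h1, hψ⟩)

end MahlerExceptional

end

theorem corollary4 (ℓ : ℕ) (hℓ : 0 < ℓ) (S : Set ℂ)
    (hS : ∀ α ∈ S, IsAlgebraic ℚ α ∧ α ∈ Metric.ball (0 : ℂ) 1)
    (hconj : ∀ α ∈ S, conj α ∈ S)
    (h0 : (0 : ℂ) ∈ S)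
    (hμ : MahlerExceptional.rootsOfUnitySet ℓ * S ⊆ S) :
    (¬ {ψ : PowerSeries ℤ |
        ψ ∈ MahlerExceptional.IntegerAnalytic ∧
        MahlerExceptional.IsTranscendentalFunction ψ ∧
        MahlerExceptional.exceptionalSet ψ = S ∧
        1 - 1 / (ℓ : ℝ) ≤
          MahlerExceptional.lowerDensity (MahlerExceptional.zeroIndices ψ)}.Countable) ∧
    ({k : ℕ | 0 < k ∧ MahlerExceptional.rootsOfUnitySet k * S ⊆ S}.Infinite →
      ¬ {ψ : PowerSeries ℤ |
        ψ ∈ MahlerExceptional.IntegerAnalytic ∧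
        MahlerExceptional.IsTranscendentalFunction ψ ∧
        MahlerExceptional.exceptionalSet ψ = S ∧
        MahlerExceptional.HasNaturalDensity
          (MahlerExceptional.zeroIndices ψ) 1}.Countable) := by
  have h := MahlerExceptional.not_countable_transcendental_exceptionalSet_eq hS hconj h0
  refine ⟨fun hc => h (hc.mono ?_), fun _ => h⟩
  rintro ψ ⟨h1, h2, h3, h4⟩
  refine ⟨h1, h2, h3, ?_⟩
  rw [MahlerExceptional.lowerDensity_eq_of_hasNaturalDensity h4]
  have : (0 : ℝ) ≤ 1 / (ℓ : ℝ) := by positivity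
  linarith
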